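/- **Completeness of $LS_{PASL}$.** Formulae are built from propositional variables $p$ by $$A ::= p \mid \top \mid \bot \mid \top^* \mid A\land A \mid A\to A \mid A * A \mid A \mathbin{-\!*} A .$$ A *separation algebra* is a partial cancellative commutative monoid $(H,\circ,\epsilon)$: $\circ$ is a partial binary operation on $H$ and $\epsilon\in H$, with $h\circ\epsilon=h$, $h_1\circ h_2=h_2\circ h_1$, $(h_1\circ h_2)\circ h_3=h_1\circ(h_2\circ h_3)$ (both sides undefined, or both defined and equal), and $h_1\circ h_2=h_1\circ h_3$ defined implies $h_2=h_3$. For a valuation $v$ of the variables by subsets of $H$: $h\Vdash p$ iff $h\in v(p)$; $\top,\bot,\land,\to$ are classical; $h\Vdash\top^*$ iff $h=\epsilon$; $h\Vdash A*B$ iff $h=h_1\circ h_2$ for some $h_1\Vdash A$, $h_2\Vdash B$; $h\Vdash A\mathbin{-\!*}B$ iff for every $h_1\Vdash A$ with $h_1\circ h$ defined, $h_1\circ h\Vdash B$. A formula is *PASL-valid* if it holds at every $h$, for every separation algebra and every valuation. *Labels* are the constant $\epsilon$ and countably infinitely many label variables. *Relational atoms* are $(x,y\triangleright z)$, $x=y$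 and $x\neq y$ for labels $x,y,z$. A *sequent* $\mathcal G;\Gamma\vdash\Delta$ consists of a finite set $\mathcal G$ of relational atoms and finite sets $\Gamma,\Delta$ of labelled formulae $w:A$; the semicolon denotes union. $E(\mathcal G)\vdash x=y$ means that $(x,y)$ is in the smallest equivalence relation on labels containing all equality atoms of $\mathcal G$. The calculus $LS_{PASL}$ has the following rules (conclusion from premises) and no cut rule: - $id$: $\mathcal G;\Gamma;w:p\vdash w':p;\Delta$ if $E(\mathcal G)\vdash w=w'$. $\quad\bot L$: $\mathcal G;\Gamma;w:\bot\vdash\Delta$. $\quad\top R$: $\mathcal G;\Gamma\vdash w:\top;\Delta$. - $\top^*L$: $\mathcal G;\Gamma;w:\top^*\vdash\Delta$ from $\mathcal G;w=\epsilon;\Gamma\vdash\Delta$. $\quad\top^*R$: $\mathcal G;\Gamma\vdash w:\top^*;\Delta$ if $E(\mathcal G)\vdash w=\epsilon$. - The usual rules $\land L,\land R,\to L,\to R$ at a fixed label $w$. - $*L$: $\mathcal G;\Gamma;z:A*B\vdash\Delta$ from $\mathcal G;(x,y\triangleright z);\Gamma;x:A;y:B\vdash\Delta$, with $x,y$ distinct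 label variables not in the conclusion. - $*R$: $\mathcal G;(x,y\triangleright z');\Gamma\vdash z:A*B;\Delta$ from $\mathcal G;(x,y\triangleright z');\Gamma\vdash x:A;z:A*B;\Delta$ and $\mathcal G;(x,y\triangleright z');\Gamma\vdash y:B;z:A*B;\Delta$, if $E(\mathcal G)\vdash z=z'$. - $-\!*L$: $\mathcal G;(x,y'\triangleright z);\Gamma;y:A\mathbin{-\!*}B\vdash\Delta$ from $\mathcal G;(x,y'\triangleright z);\Gamma;y:A\mathbin{-\!*}B\vdash x:A;\Delta$ and $\mathcal G;(x,y'\triangleright z);\Gamma;y:A\mathbin{-\!*}B;z:B\vdash\Delta$, if $E(\mathcal G)\vdash y=y'$. - $-\!*R$: $\mathcal G;\Gamma\vdash z:A\mathbin{-\!*}B;\Delta$ from $\mathcal G;(x,z\triangleright y);\Gamma;x:A\vdash y:B;\Delta$, with $x,y$ distinct label variables not in the conclusion. - $NEq$: $\mathcal G;x\neq y;\Gamma\vdash\Delta$ if $E(\mathcal G)\vdash x=y$. $\quad EM$: $\mathcal G;\Gamma\vdash\Delta$ from $\mathcal G;x=y;\Gamma\vdash\Delta$ and $\mathcal G;x\neq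 y;\Gamma\vdash\Delta$. - Structural rules, in which the listed atoms are added to those of the conclusion, going from conclusion to premise: $E$: given $(x,y\triangleright z)$ and $E(\mathcal G)\vdash y=\epsilon$, add $x=z$. $U$: add $(x,\epsilon\triangleright x)$. $Com$: given $(x,y\triangleright z)$, add $(y,x\triangleright z)$. $A$: given $(u,y\triangleright x),(v,w\triangleright y')$ and $E(\mathcal G)\vdash y=y'$, add $(z,w\triangleright x),(u,v\triangleright z)$, with $z$ a label variable not in the conclusion. $C$: given $(x,y\triangleright z),(x',w\triangleright z')$, $E(\mathcal G)\vdash x=x'$ and $E(\mathcal G)\vdash z=z'$, add $y=w$. $P$: given $(w,x\triangleright y),(w',x'\triangleright z)$, $E(\mathcal G)\vdash w=w'$ and $E(\mathcal G)\vdash x=x'$, add $y=z$. A formula $F$ is *(cut-free) provable in $LS_{PASL}$* if, for an arbitrary label $w\neq\epsilon$, the sequent $\vdash w:F$ (with no relational atoms and nothing else) is derivable by these rules. **Corollary (Completeness).** Every formula $F$ that is unprovable in $LS_{PASL}$ is not PASL-valid; contrapositively, if $F$ is PASL-valid, then $F$ is (cut-free) provable in $LS_{PASL}$. -/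

import Mathlib

universe u v

namespace PASL

/-- A separation algebra on `H`: a partial, cancellative, commutative monoid.
`op a b = none` means that the composition of `a` and `b` is undefined; the equations of
`op_comm` and `op_assoc` are Kleene equations (both sides undefined, or both defined and equal). -/
structure SeparationAlgebra (H : Type u) where
  /-- the partial composition -/
  op : H → H → Option H
  /-- the unit -/
  unit : H
  op_unit : ∀ h, op h unit = some h
  op_comm : ∀ a b, op a b = op b a
  op_assoc : ∀ a b c, ((op a b).bind fun d => op d c) = ((op b c).bind fun d => op a d)
  op_cancel : ∀ a b c d, op a b = some d → op a c = some d → b = c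

/-- Formulae of propositional abstract separation logic over the propositional variables `Var`.
(Negation and disjunction are derived connectives.) -/
inductive Formula (Var : Type v) : Type v
  /-- propositional variable -/
  | var (p : Var) : Formula Var
  /-- additive truth `⊤` -/
  | top : Formula Var
  /-- additive falsity `⊥` -/
  | bot : Formula Var
  /-- multiplicative truth `⊤*` (`emp`) -/
  | emp : Formula Var
  /-- additive conjunction `A ∧ B` -/
  | and (A B : Formula Var) : Formula Var
  /-- additive implication `A → B` -/
  | imp (A B : Formula Var) : Formula Var
  /-- separating conjunction `A * B` -/
  | star (A B : Formula Var) : Formula Var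
  /-- separating implication (magic wand) `A -* B` -/
  | wand (A B : Formula Var) : Formula Var

/-- Truth of a formula at a world `h` of a separation algebra, under a valuation `val`. -/
def Forces {H : Type u} {Var : Type v} (M : SeparationAlgebra H) (val : Var → Set H) :
    H → Formula Var → Prop
  | h, .var p => h ∈ val p
  | _, .top => True
  | _, .bot => False
  | h, .emp => h = M.unit
  | h, .and A B => Forces M val h A ∧ Forces M val h B
  | h, .imp A B => Forces M val h A → Forces M val h B
  | h, .star A B => ∃ a b, M.op a b = some h ∧ Forces M val a A ∧ Forces M val b B
  | h, .wand A B => ∀ a c, M.op a h = some c → Forces M val a A → Forces M val c B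

/-- A formula is PASL-valid if it is true at every world of every separation algebra
under every valuation. -/
def Valid {Var : Type v} (F : Formula Var) : Prop :=
  ∀ (H : Type u) (M : SeparationAlgebra H) (val : Var → Set H) (h : H), Forces M val h F

/-- Labels: the constant `ε` and countably many label variables. -/
inductive Label : Type
  | eps : Label
  | var (n : ℕ) : Label

/-- Relational atoms: `(x, y ▷ z)`, `x = y` and `x ≠ y`. -/
inductive RelAtom : Type
  | comp (x y z : Label) : RelAtom
  | eq (x y : Label) : RelAtom
  | ne (x y : Label) : RelAtom

/-- The label `l` occurs in a relational atom. -/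
def RelAtom.Mentions (l : Label) : RelAtom → Prop
  | .comp x y z => l = x ∨ l = y ∨ l = z
  | .eq x y => l = x ∨ l = y
  | .ne x y => l = x ∨ l = y

/-- The judgment `E(G) ⊢ x = y`: the equation is in the reflexive, symmetric and transitive
closure of the equality atoms of `G`. -/
inductive EqJudgment (G : Set RelAtom) : Label → Label → Prop
  | ax {x y : Label} : RelAtom.eq x y ∈ G → EqJudgment G x y
  | refl (x : Label) : EqJudgment G x x
  | symm {x y : Label} : EqJudgment G x y → EqJudgment G y x
  | trans {x y z : Label} : EqJudgment G x y → EqJudgment G y z → EqJudgment G x z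

/-- A labelled formula `w : A`. -/
abbrev LFormula (Var : Type v) : Type v := Label × Formula Var

/-- The label `l` does not occur in the sequent `G; Γ ⊢ Δ`. -/
def Fresh {Var : Type v} (l : Label) (G : Set RelAtom) (Γ Δ : Set (LFormula Var)) : Prop :=
  (∀ r ∈ G, ¬ r.Mentions l) ∧ (∀ f ∈ Γ, f.1 ≠ l) ∧ (∀ f ∈ Δ, f.1 ≠ l)

/-- Cut-free derivability of the labelled sequent `G; Γ ⊢ Δ` in `LS_PASL`. Sequents are built from
sets, so contraction is implicit; every sequent in a derivation of a finite sequent is finite.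
There is no cut rule. Labels introduced as fresh are label variables (never `ε`), are pairwise
distinct, and do not occur in the conclusion. -/
inductive Derivable {Var : Type v} :
    Set RelAtom → Set (LFormula Var) → Set (LFormula Var) → Prop
  -- Identity
  | id {G Γ Δ} {w w' : Label} {p : Var} :
      EqJudgment G w w' →
      Derivable G (insert (w, .var p) Γ) (insert (w', .var p) Δ)
  -- Logical rules
  | botL {G Γ Δ} {w : Label} :
      Derivable G (insert (w, .bot) Γ) Δ
  | topR {G Γ Δ} {w : Label} :
      Derivable G Γ (insert (w, .top) Δ)
  | empL {G Γ Δ} {w : Label} :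
      Derivable (insert (.eq w .eps) G) Γ Δ →
      Derivable G (insert (w, .emp) Γ) Δ
  | empR {G Γ Δ} {w : Label} :
      EqJudgment G w .eps →
      Derivable G Γ (insert (w, .emp) Δ)
  | andL {G Γ Δ} {w : Label} {A B : Formula Var} :
      Derivable G (insert (w, A) (insert (w, B) Γ)) Δ →
      Derivable G (insert (w, .and A B) Γ) Δ
  | andR {G Γ Δ} {w : Label} {A B : Formula Var} :
      Derivable G Γ (insert (w, A) Δ) →
      Derivable G Γ (insert (w, B) Δ) →
      Derivable G Γ (insert (w, .and A B) Δ)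
  | impL {G Γ Δ} {w : Label} {A B : Formula Var} :
      Derivable G Γ (insert (w, A) Δ) →
      Derivable G (insert (w, B) Γ) Δ →
      Derivable G (insert (w, .imp A B) Γ) Δ
  | impR {G Γ Δ} {w : Label} {A B : Formula Var} :
      Derivable G (insert (w, A) Γ) (insert (w, B) Δ) →
      Derivable G Γ (insert (w, .imp A B) Δ)
  | starL {G Γ Δ} {z : Label} {A B : Formula Var} {x y : ℕ} :
      x ≠ y →
      Fresh (.var x) G (insert (z, .star A B) Γ) Δ →
      Fresh (.var y) G (insert (z, .star A B) Γ) Δ →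
      Derivable (insert (.comp (.var x) (.var y) z) G)
        (insert (.var x, A) (insert (.var y, B) Γ)) Δ →
      Derivable G (insert (z, .star A B) Γ) Δ
  | starR {G Γ Δ} {x y z z' : Label} {A B : Formula Var} :
      EqJudgment G z z' →
      Derivable (insert (.comp x y z') G) Γ (insert (x, A) (insert (z, .star A B) Δ)) →
      Derivable (insert (.comp x y z') G) Γ (insert (y, B) (insert (z, .star A B) Δ)) →
      Derivable (insert (.comp x y z') G) Γ (insert (z, .star A B) Δ)
  | wandL {G Γ Δ} {x y y' z : Label} {A B : Formula Var} :
      EqJudgment G y y' →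
      Derivable (insert (.comp x y' z) G) (insert (y, .wand A B) Γ) (insert (x, A) Δ) →
      Derivable (insert (.comp x y' z) G) (insert (z, B) (insert (y, .wand A B) Γ)) Δ →
      Derivable (insert (.comp x y' z) G) (insert (y, .wand A B) Γ) Δ
  | wandR {G Γ Δ} {z : Label} {A B : Formula Var} {x y : ℕ} :
      x ≠ y →
      Fresh (.var x) G Γ (insert (z, .wand A B) Δ) →
      Fresh (.var y) G Γ (insert (z, .wand A B) Δ) →
      Derivable (insert (.comp (.var x) z (.var y)) G)
        (insert (.var x, A) Γ) (insert (.var y, B) Δ) →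
      Derivable G Γ (insert (z, .wand A B) Δ)
  -- Rules for equality and inequality atoms
  | neq {G Γ Δ} {x y : Label} :
      EqJudgment G x y →
      Derivable (insert (.ne x y) G) Γ Δ
  | em {G Γ Δ} (x y : Label) :
      Derivable (insert (.eq x y) G) Γ Δ →
      Derivable (insert (.ne x y) G) Γ Δ →
      Derivable G Γ Δ
  -- Structural rules for separation algebras: identity (`E` and `U`)
  | ruleE {G Γ Δ} {x y z : Label} :
      EqJudgment G y .eps →
      Derivable (insert (.eq x z) (insert (.comp x y z) G)) Γ Δ →
      Derivable (insert (.comp x y z) G) Γ Δ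
  | ruleU {G Γ Δ} (x : Label) :
      Derivable (insert (.comp x .eps x) G) Γ Δ →
      Derivable G Γ Δ
  -- Commutativity
  | ruleCom {G Γ Δ} {x y z : Label} :
      Derivable (insert (.comp y x z) (insert (.comp x y z) G)) Γ Δ →
      Derivable (insert (.comp x y z) G) Γ Δ
  -- Associativity
  | ruleA {G Γ Δ} {u v w x y y' : Label} {z : ℕ} :
      EqJudgment G y y' →
      Fresh (.var z) (insert (.comp u y x) (insert (.comp v w y') G)) Γ Δ →
      Derivable (insert (.comp (.var z) w x) (insert (.comp u v (.var z))
        (insert (.comp u y x) (insert (.comp v w y') G)))) Γ Δ →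
      Derivable (insert (.comp u y x) (insert (.comp v w y') G)) Γ Δ
  -- Cancellativity
  | ruleC {G Γ Δ} {x x' y w z z' : Label} :
      EqJudgment G x x' →
      EqJudgment G z z' →
      Derivable (insert (.eq y w) (insert (.comp x y z) (insert (.comp x' w z') G))) Γ Δ →
      Derivable (insert (.comp x y z) (insert (.comp x' w z') G)) Γ Δ
  -- Partial-determinism
  | ruleP {G Γ Δ} {w w' x x' y z : Label} :
      EqJudgment G w w' →
      EqJudgment G x x' →
      Derivable (insert (.eq y z) (insert (.comp w x y) (insert (.comp w' x' z) G))) Γ Δ →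
      Derivable (insert (.comp w x y) (insert (.comp w' x' z) G)) Γ Δ

/-- A formula `F` is (cut-free) provable in `LS_PASL` if the sequent `⊢ w : F` is cut-free
derivable for an arbitrary label `w ≠ ε`. -/
def Provable {Var : Type v} (F : Formula Var) : Prop :=
  ∀ w : Label, w ≠ .eps → Derivable ∅ ∅ {(w, F)}

end PASL

namespace PASL

open Order Set

variable {Var : Type v}

/-! Completeness is proved by a forcing-style construction instead of a scheduled proof search. The
underivable finite sequents, ordered by inclusion, form the poset. A goal is a property such as
"contains this atom" or "contains witnesses for `z : A * B` on the left". Only countably many goals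
concern the subformulae of `F`, so by Rasiowa–Sikorski (`exists_isGeneric`) the sequent `⊢ w : F`,
if underivable, lies in an ideal that decides each of them.

Read upwards, a rule turns an underivable conclusion into some larger underivable premise. So the
goal offered by the rule stays reachable from every extension, and a generic ideal must meet it
(`exists_mem_or`). Hence the union of the ideal, its limit, is saturated under the rules.

Labels modulo the equations of the limit form a separation algebra: U, Com, A, C and P give the
laws. Induction on subformulae (`forces`) shows that left formulae are true and right ones false, so
`F` fails at `w`. No cut is needed, since the limit need not decide every labelled formula. -/

/-- The subformulae of a formula. -/
def Formula.subformulas : Formula Var → Set (Formula Var)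
  | .var p => {.var p}
  | .top => {.top}
  | .bot => {.bot}
  | .emp => {.emp}
  | .and A B => insert (.and A B) (A.subformulas ∪ B.subformulas)
  | .imp A B => insert (.imp A B) (A.subformulas ∪ B.subformulas)
  | .star A B => insert (.star A B) (A.subformulas ∪ B.subformulas)
  | .wand A B => insert (.wand A B) (A.subformulas ∪ B.subformulas)

theorem Formula.self_mem_subformulas (A : Formula Var) : A ∈ A.subformulas := by
  cases A <;> simp [subformulas]

theorem Formula.countable_subformulas (A : Formula Var) : A.subformulas.Countable := by
  induction A with
  | var | top | bot | emp => exact countable_singleton _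
  | and A B hA hB | imp A B hA hB | star A B hA hB | wand A B hA hB =>
    exact (hA.union hB).insert _

/-! ### Labels, label equations and freshness. -/

theorem Label.var_injective : Function.Injective Label.var := fun _ _ h => by cases h; rfl

instance : Countable Label :=
  Function.Injective.countable (β := Option ℕ)
    (f := fun l => match l with | .eps => none | .var n => some n) fun a b h => by
      cases a <;> cases b <;> simp_all

theorem EqJudgment.mono {G G' : Set RelAtom} (h : G ⊆ G') {x y : Label}
    (hxy : EqJudgment G x y) : EqJudgment G' x y := by
  induction hxy with
  | ax hm => exact .ax (h hm)
  | refl x => exact .refl x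
  | symm _ ih => exact ih.symm
  | trans _ _ ih₁ ih₂ => exact ih₁.trans ih₂

theorem RelAtom.finite_mentions (r : RelAtom) : {n | r.Mentions (.var n)}.Finite := by
  have key (s : Set Label) (hs : s.Finite) : {n | Label.var n ∈ s}.Finite :=
    hs.preimage Label.var_injective.injOn
  cases r with
  | comp x y z => exact key {x, y, z} (by simp)
  | eq x y => exact key {x, y} (by simp)
  | ne x y => exact key {x, y} (by simp)

/-- Sequents are kept finite for this reason: it guarantees eigenvariables for `starL`, `wandR` and
`ruleA`. -/
theorem finite_not_fresh {G : Set RelAtom} {Γ Δ : Set (LFormula Var)} (hG : G.Finite)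
    (hΓ : Γ.Finite) (hΔ : Δ.Finite) : {n | ¬ Fresh (.var n) G Γ Δ}.Finite := by
  have hL (Θ : Set (LFormula Var)) (hΘ : Θ.Finite) : {n | ∃ f ∈ Θ, f.1 = Label.var n}.Finite :=
    ((hΘ.image Prod.fst).preimage Label.var_injective.injOn).subset
      fun n ⟨f, hf, hn⟩ => ⟨f, hf, hn⟩
  have hR : {n | ∃ r ∈ G, r.Mentions (.var n)}.Finite :=
    (hG.biUnion fun r _ => r.finite_mentions).subset fun n ⟨r, hr, hn⟩ => by
      simp only [mem_iUnion]; exact ⟨r, hr, hn⟩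
  refine (hR.union ((hL Γ hΓ).union (hL Δ hΔ))).subset fun n hn => ?_
  by_contra hc
  simp only [mem_union, mem_ofPred_eq, not_or, not_exists, not_and] at hc
  exact hn ⟨hc.1, hc.2.1, hc.2.2⟩

theorem exists_fresh {G : Set RelAtom} {Γ Δ : Set (LFormula Var)} (hG : G.Finite)
    (hΓ : Γ.Finite) (hΔ : Δ.Finite) :
    ∃ x y : ℕ, x ≠ y ∧ Fresh (.var x) G Γ Δ ∧ Fresh (.var y) G Γ Δ := by
  have h := finite_not_fresh hG hΓ hΔ
  obtain ⟨x, hx⟩ := h.infinite_compl.nonempty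
  obtain ⟨y, hy⟩ := (h.insert x).infinite_compl.nonempty
  simp only [mem_compl_iff, mem_insert_iff, mem_ofPred_eq, not_or, not_not] at hx hy
  exact ⟨x, y, fun h => hy.1 h.symm, hx, hy.2⟩

/-! ### The poset of underivable finite sequents. -/

variable (Var) in
/-- A finite sequent that is not derivable. -/
structure OpenSequent where
  /-- the relational atoms -/
  atoms : Set RelAtom
  /-- the antecedent -/
  left : Set (LFormula Var)
  /-- the succedent -/
  right : Set (LFormula Var)
  finite_atoms : atoms.Finite
  finite_left : left.Finite
  finite_right : right.Finite
  not_derivable : ¬ Derivable atoms left right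

namespace OpenSequent

instance : Preorder (OpenSequent Var) where
  le S T := S.atoms ⊆ T.atoms ∧ S.left ⊆ T.left ∧ S.right ⊆ T.right
  le_refl S := ⟨subset_rfl, subset_rfl, subset_rfl⟩
  le_trans S T U h k := ⟨h.1.trans k.1, h.2.1.trans k.2.1, h.2.2.trans k.2.2⟩

/-- The contexts of a rule may already contain its principal formula or atoms. Instantiated with
whole components, a rule has premises that only enlarge the conclusion, so weakening is never
needed. -/
theorem exists_ge_insert_atom {T : OpenSequent Var} {r : RelAtom}
    (h : ¬ Derivable (insert r T.atoms) T.left T.right) : ∃ U, T ≤ U ∧ r ∈ U.atoms :=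
  ⟨⟨_, _, _, T.finite_atoms.insert r, T.finite_left, T.finite_right, h⟩,
    ⟨subset_insert _ _, subset_rfl, subset_rfl⟩, mem_insert _ _⟩

theorem exists_ge_insert_left {T : OpenSequent Var} {f : LFormula Var}
    (h : ¬ Derivable T.atoms (insert f T.left) T.right) : ∃ U, T ≤ U ∧ f ∈ U.left :=
  ⟨⟨_, _, _, T.finite_atoms, T.finite_left.insert f, T.finite_right, h⟩,
    ⟨subset_rfl, subset_insert _ _, subset_rfl⟩, mem_insert _ _⟩

theorem exists_ge_insert_right {T : OpenSequent Var} {f : LFormula Var}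
    (h : ¬ Derivable T.atoms T.left (insert f T.right)) : ∃ U, T ≤ U ∧ f ∈ U.right :=
  ⟨⟨_, _, _, T.finite_atoms, T.finite_left, T.finite_right.insert f, h⟩,
    ⟨subset_rfl, subset_rfl, subset_insert _ _⟩, mem_insert _ _⟩

/-! ### Goals and generic ideals. -/

/-- The open sequents witnessing `z : A * B` in the antecedent. -/
def starWitness (z : Label) (A B : Formula Var) : Set (OpenSequent Var) :=
  {S | ∃ x y, .comp x y z ∈ S.atoms ∧ (x, A) ∈ S.left ∧ (y, B) ∈ S.left}

/-- The open sequents witnessing `z : A -* B` in the succedent. -/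
def wandWitness (z : Label) (A B : Formula Var) : Set (OpenSequent Var) :=
  {S | ∃ x y, .comp x z y ∈ S.atoms ∧ (x, A) ∈ S.left ∧ (y, B) ∈ S.right}

/-- The open sequents witnessing associativity for `u`, `v`, `w` with total composite `x`. -/
def assocWitness (u v w x : Label) : Set (OpenSequent Var) :=
  {S | ∃ z, .comp z w x ∈ S.atoms ∧ .comp u v z ∈ S.atoms}

/-- The properties of open sequents that a generic ideal decides. -/
inductive IsGoal (Φ : Set (Formula Var)) : Set (OpenSequent Var) → Prop
  | comp (x y z : Label) : IsGoal Φ {S | .comp x y z ∈ S.atoms}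
  | eq (x y : Label) : IsGoal Φ {S | .eq x y ∈ S.atoms}
  | left (w : Label) {A : Formula Var} : A ∈ Φ → IsGoal Φ {S | (w, A) ∈ S.left}
  | right (w : Label) {A : Formula Var} : A ∈ Φ → IsGoal Φ {S | (w, A) ∈ S.right}
  | star (z : Label) {A B : Formula Var} : A ∈ Φ → B ∈ Φ → IsGoal Φ (starWitness z A B)
  | wand (z : Label) {A B : Formula Var} : A ∈ Φ → B ∈ Φ → IsGoal Φ (wandWitness z A B)
  | assoc (u v w x : Label) : IsGoal Φ (assocWitness u v w x)

/-- Since `Var` is arbitrary, there may be uncountably many formulae; restricting goals to a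
countable `Φ` is what makes a generic ideal available. -/
theorem countable_isGoal {Φ : Set (Formula Var)} (hΦ : Φ.Countable) :
    {Q | IsGoal Φ Q}.Countable := by
  have := hΦ.to_subtype
  refine ((countable_range fun i : Label × Label × Label =>
      {S : OpenSequent Var | .comp i.1 i.2.1 i.2.2 ∈ S.atoms}).union <|
    (countable_range fun i : Label × Label =>
      {S : OpenSequent Var | .eq i.1 i.2 ∈ S.atoms}).union <|
    (countable_range fun i : Label × Φ => {S : OpenSequent Var | (i.1, i.2.1) ∈ S.left}).union <|
    (countable_range fun i : Label × Φ => {S : OpenSequent Var | (i.1, i.2.1) ∈ S.right}).union <|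
    (countable_range fun i : Label × Φ × Φ => starWitness i.1 i.2.1.1 i.2.2.1).union <|
    (countable_range fun i : Label × Φ × Φ => wandWitness i.1 i.2.1.1 i.2.2.1).union <|
    countable_range fun i : Label × Label × Label × Label =>
      assocWitness i.1 i.2.1 i.2.2.1 i.2.2.2).mono ?_
  rintro Q (⟨x, y, z⟩ | ⟨x, y⟩ | ⟨w, hA⟩ | ⟨w, hA⟩ | ⟨z, hA, hB⟩ | ⟨z, hA, hB⟩ | ⟨u, v, w, x⟩)
  · exact .inl ⟨(x, y, z), rfl⟩
  · exact .inr <| .inl ⟨(x, y), rfl⟩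
  · exact .inr <| .inr <| .inl ⟨(w, ⟨_, hA⟩), rfl⟩
  · exact .inr <| .inr <| .inr <| .inl ⟨(w, ⟨_, hA⟩), rfl⟩
  · exact .inr <| .inr <| .inr <| .inr <| .inl ⟨(z, ⟨_, hA⟩, ⟨_, hB⟩), rfl⟩
  · exact .inr <| .inr <| .inr <| .inr <| .inr <| .inl ⟨(z, ⟨_, hA⟩, ⟨_, hB⟩), rfl⟩
  · exact .inr <| .inr <| .inr <| .inr <| .inr <| .inr ⟨(u, v, w, x), rfl⟩

/-- An ideal of open sequents is generic for `Φ` if it decides every goal over `Φ`. -/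
def IsGeneric (Φ : Set (Formula Var)) (I : Ideal (OpenSequent Var)) : Prop :=
  ∀ Q, IsGoal Φ Q → ∃ S ∈ I, S ∈ Q ∨ ∀ T, S ≤ T → T ∉ Q

/-- The sequents deciding a goal are cofinal: either some extension meets the goal, or the sequent
itself already excludes it. An ideal can be made to meet countably many cofinal sets. -/
theorem exists_isGeneric {Φ : Set (Formula Var)} (hΦ : Φ.Countable) (S : OpenSequent Var) :
    ∃ I : Ideal (OpenSequent Var), S ∈ I ∧ IsGeneric Φ I := by
  have := (countable_isGoal hΦ).to_subtype
  let _ := Encodable.ofCountable {Q | IsGoal Φ Q}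
  let 𝒟 (Q : {Q | IsGoal Φ Q}) : Cofinal (OpenSequent Var) :=
    { carrier := {S | S ∈ Q.1 ∨ ∀ T, S ≤ T → T ∉ Q.1}
      isCofinal := fun S => by
        by_cases h : ∃ T, S ≤ T ∧ T ∈ Q.1
        · obtain ⟨T, hST, hT⟩ := h
          exact ⟨T, .inl hT, hST⟩
        · exact ⟨S, .inr fun T hST hT => h ⟨T, hST, hT⟩, le_rfl⟩ }
  refine ⟨idealOfCofinals S 𝒟, mem_idealOfCofinals S 𝒟, fun Q hQ => ?_⟩
  obtain ⟨T, hT, hTI⟩ := cofinal_meets_idealOfCofinals S 𝒟 ⟨Q, hQ⟩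
  exact ⟨T, hTI, hT⟩

namespace IsGeneric

variable {Φ : Set (Formula Var)} {I : Ideal (OpenSequent Var)}

/-- If neither goal were met, two members of `I` would exclude them for good, and a common upper
bound with `S` would contradict `h`. Which goal is reachable may depend on `T`, as needed for the
branching rules. -/
theorem exists_mem_or (hI : IsGeneric Φ I) {Q R : Set (OpenSequent Var)} (hQ : IsGoal Φ Q)
    (hR : IsGoal Φ R) {S : OpenSequent Var} (hS : S ∈ I)
    (h : ∀ T, S ≤ T → (∃ U, T ≤ U ∧ U ∈ Q) ∨ ∃ U, T ≤ U ∧ U ∈ R) :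
    (∃ T ∈ I, T ∈ Q) ∨ ∃ T ∈ I, T ∈ R := by
  obtain ⟨S₁, h₁, hd₁⟩ := hI Q hQ
  obtain ⟨S₂, h₂, hd₂⟩ := hI R hR
  rcases hd₁ with hd₁ | hd₁
  · exact .inl ⟨S₁, h₁, hd₁⟩
  rcases hd₂ with hd₂ | hd₂
  · exact .inr ⟨S₂, h₂, hd₂⟩
  obtain ⟨T, hT, hST, h₁T⟩ := I.directed S hS S₁ h₁
  obtain ⟨T', -, hTT', h₂T'⟩ := I.directed T hT S₂ h₂
  rcases h T' (hST.trans hTT') with ⟨U, hU, hUQ⟩ | ⟨U, hU, hUR⟩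
  · exact absurd hUQ (hd₁ U (h₁T.trans (hTT'.trans hU)))
  · exact absurd hUR (hd₂ U (h₂T'.trans hU))

theorem exists_mem (hI : IsGeneric Φ I) {Q : Set (OpenSequent Var)} (hQ : IsGoal Φ Q)
    {S : OpenSequent Var} (hS : S ∈ I) (h : ∀ T, S ≤ T → ∃ U, T ≤ U ∧ U ∈ Q) :
    ∃ T ∈ I, T ∈ Q :=
  or_self_iff.mp (hI.exists_mem_or hQ hQ hS fun T hT => .inl (h T hT))

end IsGeneric

/-! ### The limit of an ideal. -/

section Limit

variable (I : Ideal (OpenSequent Var))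

/-- The relational atoms of the limit of an ideal. -/
def limAtoms : Set RelAtom := {r | ∃ S ∈ I, r ∈ S.atoms}

/-- The antecedent of the limit of an ideal. -/
def limLeft : Set (LFormula Var) := {f | ∃ S ∈ I, f ∈ S.left}

/-- The succedent of the limit of an ideal. -/
def limRight : Set (LFormula Var) := {f | ∃ S ∈ I, f ∈ S.right}

/-- Equality of labels in the limit of an ideal. -/
def limSetoid : Setoid Label where
  r := EqJudgment (limAtoms I)
  iseqv := ⟨.refl, .symm, .trans⟩

/-- The worlds of the limit of an ideal: labels up to provable equality. -/
abbrev World : Type := Quotient (limSetoid I)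

/-- The world of a label. -/
abbrev world (x : Label) : World I := Quotient.mk (limSetoid I) x

variable {I}

theorem world_eq_iff {x y : Label} : world I x = world I y ↔ EqJudgment (limAtoms I) x y :=
  Quotient.eq (r := limSetoid I)

/-- An equation uses finitely many atoms, and directedness collects them in one member of the ideal.
-/
theorem exists_eqJudgment {x y : Label} (h : EqJudgment (limAtoms I) x y) :
    ∃ S ∈ I, EqJudgment S.atoms x y := by
  induction h with
  | ax h =>
    obtain ⟨S, hS, h⟩ := h
    exact ⟨S, hS, .ax h⟩
  | refl x =>
    obtain ⟨S, hS⟩ := I.nonempty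
    exact ⟨S, hS, .refl x⟩
  | symm _ ih =>
    obtain ⟨S, hS, h⟩ := ih
    exact ⟨S, hS, h.symm⟩
  | trans _ _ ih₁ ih₂ =>
    obtain ⟨S, hS, h₁⟩ := ih₁
    obtain ⟨T, hT, h₂⟩ := ih₂
    obtain ⟨U, hU, hSU, hTU⟩ := I.directed S hS T hT
    exact ⟨U, hU, (h₁.mono hSU.1).trans (h₂.mono hTU.1)⟩

/-- Facts about the limit are put in the form "at all extensions of some member", including
extensions outside `I`, because the reachability condition of `exists_mem_or` ranges over these. -/
theorem eventually_eqJudgment {x y : Label} (h : world I x = world I y) :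
    ∃ S ∈ I, ∀ T, S ≤ T → EqJudgment T.atoms x y := by
  obtain ⟨S, hS, h⟩ := exists_eqJudgment (world_eq_iff.mp h)
  exact ⟨S, hS, fun T hT => h.mono hT.1⟩

theorem eventually_atoms {r : RelAtom} (h : r ∈ limAtoms I) :
    ∃ S ∈ I, ∀ T, S ≤ T → r ∈ T.atoms := by
  obtain ⟨S, hS, h⟩ := h
  exact ⟨S, hS, fun T hT => hT.1 h⟩

theorem eventually_left {f : LFormula Var} (h : f ∈ limLeft I) :
    ∃ S ∈ I, ∀ T, S ≤ T → f ∈ T.left := by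
  obtain ⟨S, hS, h⟩ := h
  exact ⟨S, hS, fun T hT => hT.2.1 h⟩

theorem eventually_right {f : LFormula Var} (h : f ∈ limRight I) :
    ∃ S ∈ I, ∀ T, S ≤ T → f ∈ T.right := by
  obtain ⟨S, hS, h⟩ := h
  exact ⟨S, hS, fun T hT => hT.2.2 h⟩

theorem eventually_and {P Q : OpenSequent Var → Prop} (hP : ∃ S ∈ I, ∀ T, S ≤ T → P T)
    (hQ : ∃ S ∈ I, ∀ T, S ≤ T → Q T) : ∃ S ∈ I, ∀ T, S ≤ T → P T ∧ Q T := by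
  obtain ⟨S, hS, hP⟩ := hP
  obtain ⟨T, hT, hQ⟩ := hQ
  obtain ⟨U, hU, hSU, hTU⟩ := I.directed S hS T hT
  exact ⟨U, hU, fun V hV => ⟨hP V (hSU.trans hV), hQ V (hTU.trans hV)⟩⟩

end Limit

namespace IsGeneric

variable {Φ : Set (Formula Var)} {I : Ideal (OpenSequent Var)}

/-! ### Saturation under the structural rules -/

theorem comp_eps (hI : IsGeneric Φ I) (x : Label) : .comp x .eps x ∈ limAtoms I := by
  obtain ⟨S, hS⟩ := I.nonempty
  exact hI.exists_mem (.comp x .eps x) hS fun T _ =>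
    exists_ge_insert_atom fun d => T.not_derivable (.ruleU x d)

theorem comp_comm (hI : IsGeneric Φ I) {x y z : Label} (h : .comp x y z ∈ limAtoms I) :
    .comp y x z ∈ limAtoms I := by
  obtain ⟨S, hS, h⟩ := eventually_atoms h
  refine hI.exists_mem (.comp y x z) hS fun T hT => exists_ge_insert_atom fun d => ?_
  have hm := insert_eq_of_mem (h T hT)
  exact T.not_derivable (hm ▸ .ruleCom (hm.symm ▸ d))

theorem world_eq_of_eq (hI : IsGeneric Φ I) {x y : Label} {S : OpenSequent Var} (hS : S ∈ I)
    (h : ∀ T, S ≤ T → ¬ Derivable (insert (.eq x y) T.atoms) T.left T.right) :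
    world I x = world I y :=
  world_eq_iff.mpr (.ax (hI.exists_mem (.eq x y) hS fun T hT => exists_ge_insert_atom (h T hT)))

theorem comp_unique (hI : IsGeneric Φ I) {w w' x x' y z : Label}
    (h₁ : .comp w x y ∈ limAtoms I) (h₂ : .comp w' x' z ∈ limAtoms I)
    (hw : world I w = world I w') (hx : world I x = world I x') : world I y = world I z := by
  obtain ⟨S, hS, h⟩ := eventually_and (eventually_and (eventually_atoms h₁) (eventually_atoms h₂))
    (eventually_and (eventually_eqJudgment hw) (eventually_eqJudgment hx))
  refine hI.world_eq_of_eq hS fun T hT d => ?_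
  obtain ⟨⟨m₁, m₂⟩, hw, hx⟩ := h T hT
  have e₁ := insert_eq_of_mem m₁
  have e₂ := insert_eq_of_mem m₂
  have := Derivable.ruleP hw hx (by rwa [e₂, e₁] : Derivable (insert (.eq y z)
    (insert (.comp w x y) (insert (.comp w' x' z) T.atoms))) T.left T.right)
  rw [e₂, e₁] at this
  exact T.not_derivable this

theorem comp_cancel (hI : IsGeneric Φ I) {x x' y w z z' : Label}
    (h₁ : .comp x y z ∈ limAtoms I) (h₂ : .comp x' w z' ∈ limAtoms I)
    (hx : world I x = world I x') (hz : world I z = world I z') : world I y = world I w := by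
  obtain ⟨S, hS, h⟩ := eventually_and (eventually_and (eventually_atoms h₁) (eventually_atoms h₂))
    (eventually_and (eventually_eqJudgment hx) (eventually_eqJudgment hz))
  refine hI.world_eq_of_eq hS fun T hT d => ?_
  obtain ⟨⟨m₁, m₂⟩, hx, hz⟩ := h T hT
  have e₁ := insert_eq_of_mem m₁
  have e₂ := insert_eq_of_mem m₂
  have := Derivable.ruleC hx hz (by rwa [e₂, e₁] : Derivable (insert (.eq y w)
    (insert (.comp x y z) (insert (.comp x' w z') T.atoms))) T.left T.right)
  rw [e₂, e₁] at this
  exact T.not_derivable this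

/-- The intermediate label is fresh for the extension at hand and so varies with it; the goal
therefore quantifies over it. -/
theorem comp_assoc (hI : IsGeneric Φ I) {u v w x y y' : Label}
    (h₁ : .comp u y x ∈ limAtoms I) (h₂ : .comp v w y' ∈ limAtoms I)
    (hy : world I y = world I y') :
    ∃ z, .comp z w x ∈ limAtoms I ∧ .comp u v z ∈ limAtoms I := by
  obtain ⟨S, hS, h⟩ := eventually_and (eventually_and (eventually_atoms h₁) (eventually_atoms h₂))
    (eventually_eqJudgment hy)
  obtain ⟨T, hT, z, hz₁, hz₂⟩ := hI.exists_mem (.assoc u v w x) hS fun T hT => by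
    obtain ⟨⟨m₁, m₂⟩, hy⟩ := h T hT
    have e₁ := insert_eq_of_mem m₁
    have e₂ := insert_eq_of_mem m₂
    obtain ⟨z, -, -, hz, -⟩ := exists_fresh T.finite_atoms T.finite_left T.finite_right
    have hd : ¬ Derivable (insert (.comp (.var z) w x) (insert (.comp u v (.var z)) T.atoms))
        T.left T.right := fun d => by
      have := Derivable.ruleA (G := T.atoms) hy (by rwa [e₂, e₁])
        (by rwa [e₂, e₁] : Derivable (insert (.comp (.var z) w x) (insert (.comp u v (.var z))
        (insert (.comp u y x) (insert (.comp v w y') T.atoms)))) T.left T.right)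
      rw [e₂, e₁] at this
      exact T.not_derivable this
    exact ⟨⟨_, _, _, (T.finite_atoms.insert _).insert _, T.finite_left, T.finite_right, hd⟩,
      ⟨fun r hr => .inr (.inr hr), subset_rfl, subset_rfl⟩, .var z, .inl rfl, .inr (.inl rfl)⟩
  exact ⟨z, ⟨T, hT, hz₁⟩, T, hT, hz₂⟩

/-! ### Saturation under the logical rules -/

/-- By directedness both formulae and the equation would meet in one member, which would then be an
axiom. -/
theorem not_left_right_var {w w' : Label} {p : Var} (h₁ : (w, .var p) ∈ limLeft I)
    (h₂ : (w', .var p) ∈ limRight I) : world I w ≠ world I w' := fun hw => by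
  obtain ⟨S, hS, h⟩ := eventually_and (eventually_eqJudgment hw)
    (eventually_and (eventually_left h₁) (eventually_right h₂))
  obtain ⟨hw, h₁, h₂⟩ := h S le_rfl
  have := Derivable.id (Γ := S.left) (Δ := S.right) (p := p) hw
  rw [insert_eq_of_mem h₁, insert_eq_of_mem h₂] at this
  exact S.not_derivable this

theorem bot_notMem_left {w : Label} : (w, .bot) ∉ limLeft I := fun ⟨S, _, h⟩ =>
  S.not_derivable (insert_eq_of_mem h ▸ .botL)

theorem top_notMem_right {w : Label} : (w, .top) ∉ limRight I := fun ⟨S, _, h⟩ =>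
  S.not_derivable (insert_eq_of_mem h ▸ .topR)

theorem world_eq_of_emp_left (hI : IsGeneric Φ I) {w : Label} (h : (w, .emp) ∈ limLeft I) :
    world I w = world I .eps := by
  obtain ⟨S, hS, h⟩ := eventually_left h
  refine hI.world_eq_of_eq hS fun T hT d => T.not_derivable ?_
  have := Derivable.empL d
  rwa [insert_eq_of_mem (h T hT)] at this

theorem world_ne_of_emp_right {w : Label} (h : (w, .emp) ∈ limRight I) :
    world I w ≠ world I .eps := fun hw => by
  obtain ⟨S, hS, h⟩ := eventually_and (eventually_eqJudgment hw) (eventually_right h)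
  obtain ⟨hw, h⟩ := h S le_rfl
  have := Derivable.empR (Γ := S.left) (Δ := S.right) hw
  rw [insert_eq_of_mem h] at this
  exact S.not_derivable this

theorem of_and_left (hI : IsGeneric Φ I) {w : Label} {A B : Formula Var} (hA : A ∈ Φ) (hB : B ∈ Φ)
    (h : (w, .and A B) ∈ limLeft I) : (w, A) ∈ limLeft I ∧ (w, B) ∈ limLeft I := by
  obtain ⟨S, hS, h⟩ := eventually_left h
  have key (T : OpenSequent Var) (hT : S ≤ T) :
      ∃ U, T ≤ U ∧ (w, A) ∈ U.left ∧ (w, B) ∈ U.left := by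
    have hd : ¬ Derivable T.atoms (insert (w, A) (insert (w, B) T.left)) T.right := fun d => by
      have := Derivable.andL d
      rw [insert_eq_of_mem (h T hT)] at this
      exact T.not_derivable this
    exact ⟨⟨_, _, _, T.finite_atoms, (T.finite_left.insert _).insert _, T.finite_right, hd⟩,
      ⟨subset_rfl, fun r hr => .inr (.inr hr), subset_rfl⟩, .inl rfl, .inr (.inl rfl)⟩
  refine ⟨hI.exists_mem (.left w hA) hS fun T hT => ?_,
    hI.exists_mem (.left w hB) hS fun T hT => ?_⟩
  · obtain ⟨U, hU, h, -⟩ := key T hT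
    exact ⟨U, hU, h⟩
  · obtain ⟨U, hU, -, h⟩ := key T hT
    exact ⟨U, hU, h⟩

theorem of_and_right (hI : IsGeneric Φ I) {w : Label} {A B : Formula Var} (hA : A ∈ Φ)
    (hB : B ∈ Φ) (h : (w, .and A B) ∈ limRight I) :
    (w, A) ∈ limRight I ∨ (w, B) ∈ limRight I := by
  obtain ⟨S, hS, h⟩ := eventually_right h
  refine hI.exists_mem_or (.right w hA) (.right w hB) hS fun T hT => ?_
  -- If neither conjunct could be added on the right, both premises of `andR` would be derivable.
  by_contra! hc
  have := Derivable.andR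
    (not_not.mp fun hd => let ⟨U, hU, h⟩ := exists_ge_insert_right hd; hc.1 U hU h)
    (not_not.mp fun hd => let ⟨U, hU, h⟩ := exists_ge_insert_right hd; hc.2 U hU h)
  rw [insert_eq_of_mem (h T hT)] at this
  exact T.not_derivable this

theorem of_imp_left (hI : IsGeneric Φ I) {w : Label} {A B : Formula Var} (hA : A ∈ Φ)
    (hB : B ∈ Φ) (h : (w, .imp A B) ∈ limLeft I) :
    (w, A) ∈ limRight I ∨ (w, B) ∈ limLeft I := by
  obtain ⟨S, hS, h⟩ := eventually_left h
  refine hI.exists_mem_or (.right w hA) (.left w hB) hS fun T hT => ?_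
  by_contra! hc
  have := Derivable.impL
    (not_not.mp fun hd => let ⟨U, hU, h⟩ := exists_ge_insert_right hd; hc.1 U hU h)
    (not_not.mp fun hd => let ⟨U, hU, h⟩ := exists_ge_insert_left hd; hc.2 U hU h)
  rw [insert_eq_of_mem (h T hT)] at this
  exact T.not_derivable this

theorem of_imp_right (hI : IsGeneric Φ I) {w : Label} {A B : Formula Var} (hA : A ∈ Φ)
    (hB : B ∈ Φ) (h : (w, .imp A B) ∈ limRight I) :
    (w, A) ∈ limLeft I ∧ (w, B) ∈ limRight I := by
  obtain ⟨S, hS, h⟩ := eventually_right h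
  have key (T : OpenSequent Var) (hT : S ≤ T) :
      ∃ U, T ≤ U ∧ (w, A) ∈ U.left ∧ (w, B) ∈ U.right := by
    have hd : ¬ Derivable T.atoms (insert (w, A) T.left) (insert (w, B) T.right) := fun d => by
      have := Derivable.impR d
      rw [insert_eq_of_mem (h T hT)] at this
      exact T.not_derivable this
    exact ⟨⟨_, _, _, T.finite_atoms, T.finite_left.insert _, T.finite_right.insert _, hd⟩,
      ⟨subset_rfl, subset_insert _ _, subset_insert _ _⟩, .inl rfl, .inl rfl⟩
  refine ⟨hI.exists_mem (.left w hA) hS fun T hT => ?_,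
    hI.exists_mem (.right w hB) hS fun T hT => ?_⟩
  · obtain ⟨U, hU, h, -⟩ := key T hT
    exact ⟨U, hU, h⟩
  · obtain ⟨U, hU, -, h⟩ := key T hT
    exact ⟨U, hU, h⟩

/-- Unlike for conjunction, separate goals for the components would not do: the atom and both
formulae must share the same fresh labels. -/
theorem of_star_left (hI : IsGeneric Φ I) {z : Label} {A B : Formula Var} (hA : A ∈ Φ)
    (hB : B ∈ Φ) (h : (z, .star A B) ∈ limLeft I) :
    ∃ x y, .comp x y z ∈ limAtoms I ∧ (x, A) ∈ limLeft I ∧ (y, B) ∈ limLeft I := by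
  obtain ⟨S, hS, h⟩ := eventually_left h
  obtain ⟨T, hT, x, y, hxy, hx, hy⟩ := hI.exists_mem (.star z hA hB) hS fun T hT => by
    have e := insert_eq_of_mem (h T hT)
    obtain ⟨x, y, hne, hx, hy⟩ := exists_fresh T.finite_atoms T.finite_left T.finite_right
    have hd : ¬ Derivable (insert (.comp (.var x) (.var y) z) T.atoms)
        (insert (.var x, A) (insert (.var y, B) T.left)) T.right := fun d => by
      have := Derivable.starL hne (by rwa [e]) (by rwa [e]) d
      rw [e] at this
      exact T.not_derivable this
    exact ⟨⟨_, _, _, T.finite_atoms.insert _, (T.finite_left.insert _).insert _, T.finite_right,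
      hd⟩, ⟨subset_insert _ _, fun r hr => .inr (.inr hr), subset_rfl⟩,
      .var x, .var y, .inl rfl, .inl rfl, .inr (.inl rfl)⟩
  exact ⟨x, y, ⟨T, hT, hxy⟩, ⟨T, hT, hx⟩, T, hT, hy⟩

theorem of_wand_right (hI : IsGeneric Φ I) {z : Label} {A B : Formula Var} (hA : A ∈ Φ)
    (hB : B ∈ Φ) (h : (z, .wand A B) ∈ limRight I) :
    ∃ x y, .comp x z y ∈ limAtoms I ∧ (x, A) ∈ limLeft I ∧ (y, B) ∈ limRight I := by
  obtain ⟨S, hS, h⟩ := eventually_right h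
  obtain ⟨T, hT, x, y, hxy, hx, hy⟩ := hI.exists_mem (.wand z hA hB) hS fun T hT => by
    have e := insert_eq_of_mem (h T hT)
    obtain ⟨x, y, hne, hx, hy⟩ := exists_fresh T.finite_atoms T.finite_left T.finite_right
    have hd : ¬ Derivable (insert (.comp (.var x) z (.var y)) T.atoms)
        (insert (.var x, A) T.left) (insert (.var y, B) T.right) := fun d => by
      have := Derivable.wandR hne (by rwa [e]) (by rwa [e]) d
      rw [e] at this
      exact T.not_derivable this
    exact ⟨⟨_, _, _, T.finite_atoms.insert _, T.finite_left.insert _, T.finite_right.insert _,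
      hd⟩, ⟨subset_insert _ _, subset_insert _ _, subset_insert _ _⟩,
      .var x, .var y, .inl rfl, .inl rfl, .inl rfl⟩
  exact ⟨x, y, ⟨T, hT, hxy⟩, ⟨T, hT, hx⟩, T, hT, hy⟩

/-- Two labels `z`, `z'` are needed because a composition of worlds may be witnessed at another
representative. -/
theorem of_star_right (hI : IsGeneric Φ I) {x y z z' : Label} {A B : Formula Var} (hA : A ∈ Φ)
    (hB : B ∈ Φ) (h : (z, .star A B) ∈ limRight I) (hc : .comp x y z' ∈ limAtoms I)
    (hz : world I z = world I z') : (x, A) ∈ limRight I ∨ (y, B) ∈ limRight I := by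
  obtain ⟨S, hS, h⟩ := eventually_and (eventually_right h)
    (eventually_and (eventually_atoms hc) (eventually_eqJudgment hz))
  refine hI.exists_mem_or (.right x hA) (.right y hB) hS fun T hT => ?_
  obtain ⟨h, hc, hz⟩ := h T hT
  have e₁ := insert_eq_of_mem h
  have e₂ := insert_eq_of_mem hc
  by_contra! hn
  have := Derivable.starR (x := x) (y := y) (G := T.atoms) (Γ := T.left) (Δ := T.right)
    (A := A) (B := B) hz
    (by rw [e₁, e₂]; exact not_not.mp fun hd =>
          let ⟨U, hU, h⟩ := exists_ge_insert_right hd; hn.1 U hU h)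
    (by rw [e₁, e₂]; exact not_not.mp fun hd =>
          let ⟨U, hU, h⟩ := exists_ge_insert_right hd; hn.2 U hU h)
  rw [e₁, e₂] at this
  exact T.not_derivable this

theorem of_wand_left (hI : IsGeneric Φ I) {x y y' z : Label} {A B : Formula Var} (hA : A ∈ Φ)
    (hB : B ∈ Φ) (h : (y, .wand A B) ∈ limLeft I) (hc : .comp x y' z ∈ limAtoms I)
    (hy : world I y = world I y') : (x, A) ∈ limRight I ∨ (z, B) ∈ limLeft I := by
  obtain ⟨S, hS, h⟩ := eventually_and (eventually_left h)
    (eventually_and (eventually_atoms hc) (eventually_eqJudgment hy))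
  refine hI.exists_mem_or (.right x hA) (.left z hB) hS fun T hT => ?_
  obtain ⟨h, hc, hy⟩ := h T hT
  have e₁ := insert_eq_of_mem h
  have e₂ := insert_eq_of_mem hc
  by_contra! hn
  have := Derivable.wandL (x := x) (z := z) (G := T.atoms) (Γ := T.left) (Δ := T.right)
    (A := A) (B := B) hy
    (by rw [e₁, e₂]; exact not_not.mp fun hd =>
          let ⟨U, hU, h⟩ := exists_ge_insert_right hd; hn.1 U hU h)
    (by rw [e₁, e₂]; exact not_not.mp fun hd =>
          let ⟨U, hU, h⟩ := exists_ge_insert_left hd; hn.2 U hU h)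
  rw [e₁, e₂] at this
  exact T.not_derivable this

end IsGeneric

/-! ### The countermodel -/

/-- The composition relation on the worlds of the limit of an ideal. -/
def Comp (I : Ideal (OpenSequent Var)) (a b c : World I) : Prop :=
  ∃ x y z, .comp x y z ∈ limAtoms I ∧ world I x = a ∧ world I y = b ∧ world I z = c

namespace IsGeneric

variable {Φ : Set (Formula Var)} {I : Ideal (OpenSequent Var)}

theorem Comp.comm (hI : IsGeneric Φ I) {a b c : World I} (h : Comp I a b c) : Comp I b a c := by
  obtain ⟨x, y, z, h, hx, hy, hz⟩ := h
  exact ⟨y, x, z, hI.comp_comm h, hy, hx, hz⟩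

theorem Comp.unique (hI : IsGeneric Φ I) {a b c d : World I} (h₁ : Comp I a b c)
    (h₂ : Comp I a b d) : c = d := by
  obtain ⟨x, y, z, h₁, rfl, rfl, rfl⟩ := h₁
  obtain ⟨x', y', z', h₂, hx, hy, rfl⟩ := h₂
  exact hI.comp_unique h₁ h₂ hx.symm hy.symm

theorem Comp.assoc (hI : IsGeneric Φ I) {a b c d e : World I} (h₁ : Comp I b c d)
    (h₂ : Comp I a d e) : ∃ f, Comp I a b f ∧ Comp I f c e := by
  obtain ⟨v, w, y', h₁, rfl, rfl, rfl⟩ := h₁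
  obtain ⟨u, y, x, h₂, rfl, hy, rfl⟩ := h₂
  obtain ⟨z, hz₁, hz₂⟩ := hI.comp_assoc h₂ h₁ hy
  exact ⟨world I z, ⟨u, v, z, hz₂, rfl, rfl, rfl⟩, z, w, x, hz₁, rfl, rfl, rfl⟩

/-- The composite of two worlds, if there is one. -/
noncomputable def compose (I : Ideal (OpenSequent Var)) (a b : World I) : Option (World I) :=
  open Classical in if h : ∃ c, Comp I a b c then some h.choose else none

theorem compose_eq_some (hI : IsGeneric Φ I) {a b c : World I} :
    compose I a b = some c ↔ Comp I a b c := by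
  unfold compose
  split_ifs with h
  · exact ⟨fun e => Option.some.inj e ▸ h.choose_spec,
      fun hc => congrArg some (Comp.unique hI h.choose_spec hc)⟩
  · exact ⟨fun e => by simp at e, fun hc => absurd ⟨c, hc⟩ h⟩

/-- The separation algebra of the worlds of the limit of a generic ideal, lifted to any
universe. -/
noncomputable def separationAlgebra (hI : IsGeneric Φ I) :
    SeparationAlgebra (ULift.{u} (World I)) where
  op a b := (compose I a.down b.down).map ULift.up
  unit := ⟨world I .eps⟩
  op_unit := fun ⟨h⟩ => by
    induction h using Quotient.inductionOn with
    | h x =>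
      -- Rule U supplies this composite; P, through `compose_eq_some`, makes it the only one.
      have : compose I (world I x) (world I .eps) = some (world I x) :=
        hI.compose_eq_some.mpr ⟨x, .eps, x, hI.comp_eps x, rfl, rfl, rfl⟩
      simp [this]
  op_comm a b := by
    congr 1
    ext c
    rw [hI.compose_eq_some, hI.compose_eq_some]
    exact ⟨Comp.comm hI, Comp.comm hI⟩
  op_assoc a b c := by
    ext ⟨e⟩
    simp only [Option.bind_eq_some_iff, Option.map_eq_some_iff, hI.compose_eq_some]
    constructor
    · rintro ⟨_, ⟨d, h₁, rfl⟩, e', h₂, he⟩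
      obtain rfl : e' = e := congrArg ULift.down he
      -- `Comp.assoc` regroups in one direction only; the other follows by applying it to the
      -- commuted compositions.
      obtain ⟨f, hf₁, hf₂⟩ := Comp.assoc hI (Comp.comm hI h₁) (Comp.comm hI h₂)
      exact ⟨⟨f⟩, ⟨f, Comp.comm hI hf₁, rfl⟩, _, Comp.comm hI hf₂, rfl⟩
    · rintro ⟨_, ⟨d, h₁, rfl⟩, e', h₂, he⟩
      obtain rfl : e' = e := congrArg ULift.down he
      obtain ⟨f, hf₁, hf₂⟩ := Comp.assoc hI h₁ h₂
      exact ⟨⟨f⟩, ⟨f, hf₁, rfl⟩, _, hf₂, rfl⟩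
  op_cancel a b c d h₁ h₂ := by
    obtain ⟨d', e₁, rfl⟩ := Option.map_eq_some_iff.mp h₁
    obtain ⟨d'', e₂, h⟩ := Option.map_eq_some_iff.mp h₂
    obtain ⟨x, y, z, h₁, hx, hy, hz⟩ := hI.compose_eq_some.mp e₁
    obtain ⟨x', y', z', h₂, hx', hy', hz'⟩ := hI.compose_eq_some.mp e₂
    have hd : d'' = d' := congrArg ULift.down h
    exact ULift.down_injective (hy.symm.trans ((hI.comp_cancel h₁ h₂ (hx.trans hx'.symm)
      (hz.trans (hd.symm.trans hz'.symm))).trans hy'))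

theorem op_eq_some (hI : IsGeneric Φ I) {a b c : ULift.{u} (World I)} :
    (separationAlgebra hI).op a b = some c ↔ Comp I a.down b.down c.down := by
  obtain ⟨c⟩ := c
  rw [← hI.compose_eq_some]
  simp [separationAlgebra]

/-- The valuation read off from the antecedent of the limit of an ideal. -/
def valuation (I : Ideal (OpenSequent Var)) (p : Var) : Set (ULift.{u} (World I)) :=
  {h | ∃ w, world I w = h.down ∧ (w, .var p) ∈ limLeft I}

/-- Both halves are proved together because `imp` and `wand` move a subformula to the other side. -/
theorem forces (hI : IsGeneric Φ I) {A : Formula Var} (hA : A.subformulas ⊆ Φ) (w : Label) :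
    ((w, A) ∈ limLeft I →
      Forces (separationAlgebra.{u} hI) (valuation I) ⟨world I w⟩ A) ∧
    ((w, A) ∈ limRight I →
      ¬ Forces (separationAlgebra.{u} hI) (valuation I) ⟨world I w⟩ A) := by
  induction A generalizing w with
  | var p =>
    exact ⟨fun h => ⟨w, rfl, h⟩, fun h ⟨w', hw, h'⟩ => not_left_right_var h' h hw⟩
  | top => exact ⟨fun _ => trivial, fun h => absurd h top_notMem_right⟩
  | bot => exact ⟨fun h => absurd h bot_notMem_left, fun _ h => h⟩
  | emp =>
    exact ⟨fun h => congrArg ULift.up (hI.world_eq_of_emp_left h),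
      fun h hw => world_ne_of_emp_right h (congrArg ULift.down hw)⟩
  | and A B ihA ihB =>
    obtain ⟨hAs, hBs⟩ := union_subset_iff.mp ((subset_insert _ _).trans hA)
    have hA := hAs A.self_mem_subformulas
    have hB := hBs B.self_mem_subformulas
    refine ⟨fun h => ?_, fun h hf => ?_⟩
    · obtain ⟨h₁, h₂⟩ := hI.of_and_left hA hB h
      exact ⟨(ihA hAs w).1 h₁, (ihB hBs w).1 h₂⟩
    · rcases hI.of_and_right hA hB h with h | h
      · exact (ihA hAs w).2 h hf.1
      · exact (ihB hBs w).2 h hf.2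
  | imp A B ihA ihB =>
    obtain ⟨hAs, hBs⟩ := union_subset_iff.mp ((subset_insert _ _).trans hA)
    have hA := hAs A.self_mem_subformulas
    have hB := hBs B.self_mem_subformulas
    refine ⟨fun h hf => ?_, fun h hf => ?_⟩
    · rcases hI.of_imp_left hA hB h with h | h
      · exact absurd hf ((ihA hAs w).2 h)
      · exact (ihB hBs w).1 h
    · obtain ⟨h₁, h₂⟩ := hI.of_imp_right hA hB h
      exact (ihB hBs w).2 h₂ (hf ((ihA hAs w).1 h₁))
  | star A B ihA ihB =>
    obtain ⟨hAs, hBs⟩ := union_subset_iff.mp ((subset_insert _ _).trans hA)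
    have hA := hAs A.self_mem_subformulas
    have hB := hBs B.self_mem_subformulas
    refine ⟨fun h => ?_, fun h => ?_⟩
    · obtain ⟨x, y, hc, hx, hy⟩ := hI.of_star_left hA hB h
      exact ⟨⟨world I x⟩, ⟨world I y⟩, hI.op_eq_some.mpr ⟨x, y, w, hc, rfl, rfl, rfl⟩,
        (ihA hAs x).1 hx, (ihB hBs y).1 hy⟩
    · rintro ⟨⟨a⟩, ⟨b⟩, hab, ha, hb⟩
      obtain ⟨x, y, z, hc, rfl, rfl, hz⟩ := hI.op_eq_some.mp hab
      rcases hI.of_star_right hA hB h hc hz.symm with h | h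
      · exact (ihA hAs x).2 h ha
      · exact (ihB hBs y).2 h hb
  | wand A B ihA ihB =>
    obtain ⟨hAs, hBs⟩ := union_subset_iff.mp ((subset_insert _ _).trans hA)
    have hA := hAs A.self_mem_subformulas
    have hB := hBs B.self_mem_subformulas
    refine ⟨fun h => ?_, fun h hf => ?_⟩
    · rintro ⟨a⟩ ⟨c⟩ hac ha
      obtain ⟨x, y, z, hc, rfl, hy, rfl⟩ := hI.op_eq_some.mp hac
      rcases hI.of_wand_left hA hB h hc hy.symm with h | h
      · exact absurd ha ((ihA hAs x).2 h)
      · exact (ihB hBs z).1 h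
    · obtain ⟨x, y, hc, hx, hy⟩ := hI.of_wand_right hA hB h
      exact (ihB hBs y).2 hy (hf ⟨world I x⟩ ⟨world I y⟩
        (hI.op_eq_some.mpr ⟨x, w, y, hc, rfl, rfl, rfl⟩) ((ihA hAs x).1 hx))

end IsGeneric

end OpenSequent

/-! ### Completeness. -/

theorem Provable.of_valid {F : Formula Var} (hF : Valid.{u} F) : Provable F := by
  intro w _
  by_contra hd
  obtain ⟨I, hS, hI⟩ := OpenSequent.exists_isGeneric F.countable_subformulas
    ⟨∅, ∅, {(w, F)}, finite_empty, finite_empty, finite_singleton _, hd⟩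
  exact (hI.forces subset_rfl w).2 ⟨_, hS, mem_singleton _⟩ (hF _ _ _ _)

end PASL

theorem mainTheorem2 {Var : Type v} (F : PASL.Formula Var) :
    (¬ PASL.Provable F → ¬ PASL.Valid.{u} F) ∧ (PASL.Valid.{u} F → PASL.Provable F) :=
  ⟨mt PASL.Provable.of_valid, PASL.Provable.of_valid⟩
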